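/- Let $r\ge 2$ be an integer. An $r$-graph on a vertex set $V$ is a hypergraph without repeated edges, all of whose edges are $r$-element subsets of $V$. For $k\ge 2$, an $r$-graph contains a Berge-$C_k$ if it has $k$ distinct vertices $v_1,\dots,v_k$ and $k$ distinct edges $e_1,\dots,e_k$ with $v_i,v_{i+1}\in e_i$ for all $i$ (indices modulo $k$). The girth of an $r$-graph is the smallest $k\ge 2$ for which it contains a Berge-$C_k$ (and $\infty$ if there is no such $k$). There is a constant $C=C(r)$ such that for every integer $n\ge 0$ the number of $r$-graphs with vertex set $\{1,\dots,n\}$ and girth at least $5$, i.e. containing no Berge-$C_2$, Berge-$C_3$ or Berge-$C_4$, is at most $2^{Cn^{3/2}}$. -/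

import Mathlib

namespace BergeGirth

open Set

/-- The hypergraph `H` is a Berge-`F`, for a multigraph `F`: up to identifying the vertices of `F`
with distinct vertices of `H`, there is a bijection `f : E(F) → E(H)` with `e ⊆ f e` for every
edge `e` of `F`. -/
def IsBerge {α β γ : Type*} (F : Graph β γ) (H : Hypergraph α) : Prop :=
  ∃ φ : β → α, InjOn φ F.vertexSet ∧ MapsTo φ F.vertexSet H.vertexSet ∧
    ∃ f : γ → Set α, BijOn f F.edgeSet H.edgeSet ∧
      ∀ e x y, F.IsLink e x y → φ x ∈ f e ∧ φ y ∈ f e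

/-- Being a subhypergraph. -/
def IsSubhypergraph {α : Type*} (H' H : Hypergraph α) : Prop :=
  H'.vertexSet ⊆ H.vertexSet ∧ H'.edgeSet ⊆ H.edgeSet

/-- `H` contains a Berge-`F`, that is, some subhypergraph of `H` is a Berge-`F`. -/
def ContainsBerge {α β γ : Type*} (F : Graph β γ) (H : Hypergraph α) : Prop :=
  ∃ H' : Hypergraph α, IsSubhypergraph H' H ∧ IsBerge F H'

/-- The cycle `C_k` as a multigraph on the vertices `0, …, k - 1`: the edge number `i` joins `i`
to its cyclic successor. In particular `C_2` consists of two parallel edges. -/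
def cycle (k : ℕ) : Graph (Fin k) (Fin k) where
  vertexSet := univ
  IsLink i x y := (x = i ∧ y = finRotate k i) ∨ (x = finRotate k i ∧ y = i)
  edgeSet := univ
  isLink_symm := fun _ _ => ⟨fun _ _ h => h.symm.imp And.symm And.symm⟩
  eq_or_eq_of_isLink_of_isLink := by
    rintro e x y v w (⟨rfl, rfl⟩ | ⟨rfl, rfl⟩) (⟨rfl, rfl⟩ | ⟨rfl, rfl⟩) <;> simp
  edge_mem_iff_exists_isLink := fun e => by
    simp only [mem_univ, true_iff]
    exact ⟨e, finRotate k e, Or.inl ⟨rfl, rfl⟩⟩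
  left_mem_of_isLink := fun _ _ _ _ => mem_univ _

/-- The girth of `H`: the smallest `k ≥ 2` such that `H` contains a Berge-`C_k`, and `⊤` if there
is no such `k`. -/
noncomputable def girth {α : Type*} (H : Hypergraph α) : ℕ∞ :=
  ⨅ k ∈ {k : ℕ | 2 ≤ k ∧ ContainsBerge (cycle k) H}, (k : ℕ∞)

/-- `H` is `r`-uniform (an `r`-graph). -/
def IsUniform {α : Type*} (r : ℕ) (H : Hypergraph α) : Prop :=
  ∀ e ∈ H.edgeSet, e.encard = r

/-- The `r`-graphs with vertex set `{0, …, n - 1}` whose girth is at least `g`. -/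
def rGraphsOfGirthAtLeast (r n g : ℕ) : Set (Hypergraph (Fin n)) :=
  {H | H.vertexSet = univ ∧ IsUniform r H ∧ (g : ℕ∞) ≤ girth H}

/-- There are only finitely many hypergraphs on a finite set, so counting them with `Set.ncard`
is meaningful. -/
instance finite_hypergraph {α : Type*} [Finite α] : Finite (Hypergraph α) :=
  Finite.of_injective (fun H : Hypergraph α => (H.vertexSet, H.edgeSet)) fun H K h => by
    simp only [Prod.mk.injEq] at h
    exact Hypergraph.ext h.1 h.2

/-- Girth at least `g` means containing no Berge-`C_k` with `2 ≤ k < g`. -/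
theorem le_girth_iff {α : Type*} (H : Hypergraph α) (g : ℕ) :
    (g : ℕ∞) ≤ girth H ↔ ∀ k, 2 ≤ k → k < g → ¬ ContainsBerge (cycle k) H := by
  simp only [girth, le_iInf_iff, mem_ofPred_eq, Nat.cast_le]
  exact ⟨fun h k h2 hk hc => absurd (h k ⟨h2, hc⟩) (not_le.2 hk),
    fun h k hk => not_lt.1 fun hlt => h k hk.1 hlt hk.2⟩

/-- The usual description of Berge cycles: distinct vertices and distinct edges such that the
`i`-th edge contains the `i`-th vertex and the next one. -/
theorem containsBerge_cycle_iff {α : Type*} (H : Hypergraph α) (k : ℕ) :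
    ContainsBerge (cycle k) H ↔ ∃ (v : Fin k → α) (f : Fin k → Set α),
      Function.Injective v ∧ Function.Injective f ∧
        ∀ i, f i ∈ H.edgeSet ∧ v i ∈ f i ∧ v (finRotate k i) ∈ f i := by
  constructor
  · rintro ⟨H', ⟨-, hE⟩, φ, hφ, -, f, hf, hl⟩
    refine ⟨φ, f, injOn_univ.1 hφ, injOn_univ.1 hf.injOn, fun i => ?_⟩
    exact ⟨hE (hf.mapsTo (mem_univ i)), hl i _ _ (Or.inl ⟨rfl, rfl⟩)⟩
  · rintro ⟨v, f, hv, hf, h⟩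
    refine ⟨⟨H.vertexSet, range f, ?_⟩, ⟨subset_rfl, ?_⟩, v, hv.injOn, ?_, f, ?_, ?_⟩
    · rintro _ ⟨i, rfl⟩
      exact H.subset_vertexSet_of_mem_edgeSet' (h i).1
    · rintro _ ⟨i, rfl⟩
      exact (h i).1
    · exact fun i _ => H.subset_vertexSet_of_mem_edgeSet' (h i).1 (h i).2.1
    · exact ⟨fun i _ => mem_range_self i, hf.injOn, by rintro _ ⟨i, rfl⟩; exact ⟨i, mem_univ i, rfl⟩⟩
    · rintro e x y (⟨rfl, rfl⟩ | ⟨rfl, rfl⟩)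
      · exact (h _).2
      · exact (h _).2.symm

end BergeGirth

/-! Without Berge 2- and 3-cycles, vertices that pairwise share hyperedges lie in a common one, so
an `r`-graph is determined by its shadow. Split the shadow into the `r * r` graphs `positionGraph H
i j`. A hyperedge yields at most one edge of each, so a 4-cycle there would use four distinct
hyperedges and be a Berge 4-cycle. Thus `r`-graphs of girth at least 5 inject into `r * r`-tuples of
`C_4`-free graphs.

The latter are counted as by Kleitman and Winston. Delete a vertex of minimum degree: its
neighbourhood `S` is independent in the common-neighbour graph of the rest. If the rest has minimum
degree `d`, then `|S| ≤ d + 1`, and by Cauchy–Schwarz every set of at least `2n/d` vertices spans a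
vertex of relative degree at least `d²/(2n)` in that graph. The container algorithm then leaves `exp
(O(√n))` choices for `S`, and induction on `n` gives `exp (O(n^(3/2)))`. -/

namespace BergeGirth

/-! ### Counting independent sets and small subsets -/

/-- If every large set of vertices spans a vertex of large relative degree, then there are few
independent sets: this is the counting form of the graph container algorithm. -/
theorem card_independent_le {V : Type*} [DecidableEq V] (A : V → V → Prop) [DecidableRel A]
    {β R D : ℝ} (m : ℕ) (hβ : β ≤ 1)
    (hdeg : ∀ U : Finset V, R < U.card → ∃ v ∈ U, β * U.card ≤ ((U.filter (A v)).card : ℝ))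
    (hD : ∀ U : Finset V, (U.card : ℝ) ≤ R →
      ((U.powerset.filter (fun S => S.card ≤ m)).card : ℝ) ≤ D)
    (hD0 : 0 ≤ D) (q : ℕ) (U : Finset V) (hU : (U.card : ℝ) * (1 - β) ^ q ≤ R) :
    ((U.powerset.filter (fun S => S.card ≤ m ∧ ∀ a ∈ S, ∀ b ∈ S, ¬ A a b)).card : ℝ) ≤
      ((U.card : ℝ) + 1) ^ q * D := by
  induction U using Finset.strongInduction generalizing q with
  | H U ih =>
  have hpow : ∀ k : ℕ, (1 : ℝ) ≤ ((U.card : ℝ) + 1) ^ k := fun k =>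
    one_le_pow₀ (by linarith [Nat.cast_nonneg (α := ℝ) U.card])
  by_cases hR : (U.card : ℝ) ≤ R
  · refine le_trans ?_ ((hD U hR).trans (le_mul_of_one_le_left hD0 (hpow q)))
    exact Nat.cast_le.2 <| Finset.card_le_card fun S hS =>
      Finset.mem_filter.2 ⟨(Finset.mem_filter.1 hS).1, (Finset.mem_filter.1 hS).2.1⟩
  push Not at hR
  obtain ⟨v, hv, hvd⟩ := hdeg U hR
  cases q with
  | zero => simp at hU; linarith
  | succ q =>
  -- If `v ∈ S`, the rest of `S` lies in `W`, which is smaller by a factor `1 - β`; this spends one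
  -- unit of `q`. If `v ∉ S`, only `v` is dropped and `q` is kept. The bound follows from `u^(q+1) +
  -- (u+1)^q ≤ (u+1)^(q+1)`.
  set W := (U.erase v).filter (fun u => ¬ A v u) with hW
  have hWU : W ⊂ U := lt_of_le_of_lt (Finset.filter_subset _ _) (Finset.erase_ssubset hv)
  have hWcard : (W.card : ℝ) ≤ (1 - β) * U.card := by
    have h1 : W.card ≤ (U.filter (fun u => ¬ A v u)).card :=
      Finset.card_le_card (Finset.filter_subset_filter _ (Finset.erase_subset _ _))
    have h2 := Finset.card_filter_add_card_filter_not (s := U) (A v)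
    have h1' : (W.card : ℝ) ≤ ((U.filter (fun u => ¬ A v u)).card : ℝ) := by exact_mod_cast h1
    have h2' : ((U.filter (A v)).card : ℝ) + ((U.filter (fun u => ¬ A v u)).card : ℝ) = U.card := by
      exact_mod_cast h2
    linarith
  have hE := ih (U.erase v) (Finset.erase_ssubset hv) (q + 1) <| by
    refine le_trans ?_ hU
    have : ((U.erase v).card : ℝ) ≤ U.card := by
      exact_mod_cast Finset.card_le_card (Finset.erase_subset _ _)
    exact mul_le_mul_of_nonneg_right this (pow_nonneg (by linarith) _)
  have hN := ih W hWU q <| by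
    refine le_trans (mul_le_mul_of_nonneg_right hWcard (pow_nonneg (by linarith) _)) ?_
    refine le_trans (le_of_eq ?_) hU
    ring
  have hsplit : (U.powerset.filter (fun S => S.card ≤ m ∧ ∀ a ∈ S, ∀ b ∈ S, ¬ A a b)).card ≤
      ((U.erase v).powerset.filter (fun S => S.card ≤ m ∧ ∀ a ∈ S, ∀ b ∈ S, ¬ A a b)).card +
      (W.powerset.filter (fun S => S.card ≤ m ∧ ∀ a ∈ S, ∀ b ∈ S, ¬ A a b)).card := by
    rw [← Finset.card_image_of_injOn (f := insert v) (s := W.powerset.filter _)]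
    · refine le_trans (Finset.card_le_card ?_) (Finset.card_union_le _ _)
      intro S hS
      simp only [Finset.mem_filter, Finset.mem_powerset, Finset.mem_union, Finset.mem_image] at hS ⊢
      by_cases hvS : v ∈ S
      · right
        refine ⟨S.erase v, ⟨?_, (Finset.card_erase_le).trans hS.2.1, fun a ha b hb =>
          hS.2.2 a (Finset.mem_of_mem_erase ha) b (Finset.mem_of_mem_erase hb)⟩,
          Finset.insert_erase hvS⟩
        intro u hu
        have hu' := Finset.mem_of_mem_erase hu
        exact Finset.mem_filter.2 ⟨Finset.mem_erase.2 ⟨Finset.ne_of_mem_erase hu, hS.1 hu'⟩,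
          hS.2.2 v hvS u hu'⟩
      · exact Or.inl ⟨Finset.subset_erase.2 ⟨hS.1, hvS⟩, hS.2⟩
    · have hvW : ∀ S ∈ W.powerset.filter
          (fun S => S.card ≤ m ∧ ∀ a ∈ S, ∀ b ∈ S, ¬ A a b), v ∉ S := by
        intro S hS hvS
        have := (Finset.mem_powerset.1 (Finset.mem_filter.1 hS).1) hvS
        simp [hW] at this
      intro S hS T hT h
      have h' : insert v S = insert v T := h
      rw [← Finset.erase_insert (hvW S hS), h', Finset.erase_insert (hvW T hT)]
  have hsplit' : ((U.powerset.filter (fun S => S.card ≤ m ∧ ∀ a ∈ S, ∀ b ∈ S, ¬ A a b)).card : ℝ) ≤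
      ((U.erase v).powerset.filter (fun S => S.card ≤ m ∧ ∀ a ∈ S, ∀ b ∈ S, ¬ A a b)).card +
      (W.powerset.filter (fun S => S.card ≤ m ∧ ∀ a ∈ S, ∀ b ∈ S, ¬ A a b)).card := by
    exact_mod_cast hsplit
  have hEc : ((U.erase v).card : ℝ) + 1 = U.card := by
    exact_mod_cast Finset.card_erase_add_one hv
  have hWc : (W.card : ℝ) ≤ U.card := by exact_mod_cast Finset.card_le_card hWU.subset
  rw [hEc] at hE
  have hN' : ((W.card : ℝ) + 1) ^ q * D ≤ ((U.card : ℝ) + 1) ^ q * D := by gcongr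
  have hE' : (U.card : ℝ) ^ (q + 1) * D ≤ ((U.card : ℝ) + 1) ^ q * U.card * D := by
    rw [pow_succ]; gcongr; linarith
  calc _ ≤ _ := hsplit'
    _ ≤ ((U.card : ℝ) + 1) ^ q * U.card * D + ((U.card : ℝ) + 1) ^ q * D := by linarith
    _ = _ := by ring

/-- Weight each subset `S` by `x^(-|S|)`: the total is `(1 + 1/x)^|U|`, and every counted set weighs
at least `x^(-m)`. -/
theorem card_powerset_filter_card_le {V : Type*} (U : Finset V) (m : ℕ) {x : ℝ} (hx : 1 ≤ x) :
    ((U.powerset.filter (fun S => S.card ≤ m)).card : ℝ) ≤ x ^ m * Real.exp (U.card / x) := by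
  have hx0 : 0 < x := by linarith
  have hsum : ∑ S ∈ U.powerset, (x⁻¹) ^ S.card = (x⁻¹ + 1) ^ U.card := by
    simpa using Finset.sum_pow_mul_eq_add_pow x⁻¹ 1 U
  have h1 : ((U.powerset.filter (fun S => S.card ≤ m)).card : ℝ) * (x⁻¹) ^ m ≤
      (x⁻¹ + 1) ^ U.card := by
    rw [← hsum, ← nsmul_eq_mul]
    refine le_trans (Finset.card_nsmul_le_sum _ (fun S => x⁻¹ ^ S.card) _ fun S hS => ?_)
      (Finset.sum_le_sum_of_subset_of_nonneg (Finset.filter_subset _ _)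
        fun _ _ _ => by positivity)
    exact pow_le_pow_of_le_one (by positivity) (inv_le_one_of_one_le₀ hx) (Finset.mem_filter.1 hS).2
  have h2 : (x⁻¹ + 1) ^ U.card ≤ Real.exp (U.card / x) := by
    rw [div_eq_mul_inv, Real.exp_nat_mul]
    exact pow_le_pow_left₀ (by positivity) (Real.add_one_le_exp _) _
  have h3 := h1.trans h2
  rw [inv_pow, ← div_eq_mul_inv, div_le_iff₀ (by positivity)] at h3
  linarith

/-! ### Common neighbours in `C_4`-free graphs -/

/-- `G` contains no cycle of length four. -/
def IsC4Free {V : Type*} (G : SimpleGraph V) : Prop :=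
  ∀ a b c d, a ≠ b → c ≠ d → G.Adj a c → G.Adj c b → G.Adj b d → ¬ G.Adj d a

/-- Two distinct vertices with a common neighbour. -/
def HasCommonNbr {V : Type*} (G : SimpleGraph V) (u v : V) : Prop :=
  u ≠ v ∧ ∃ w, G.Adj u w ∧ G.Adj v w

-- Count ordered pairs in `U` by common neighbour: `C_4`-freeness counts each at most once. With `s`
-- the degree sum over `U` and `e` the number of pairs, Cauchy–Schwarz gives `s² ≤ n(s + e)`. Since
-- `s ≥ d|U| ≥ 2n`, this yields `e ≥ s²/(2n)`; average over `U`.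
open Classical in
theorem exists_many_hasCommonNbr {V : Type*} [Fintype V] {G : SimpleGraph V} (hG : IsC4Free G)
    {d : ℕ} (hd : ∀ v, d ≤ G.degree v) (U : Finset V) (hU0 : U.Nonempty)
    (hU : 2 * (Fintype.card V : ℝ) ≤ d * U.card) :
    ∃ v ∈ U, (d : ℝ) ^ 2 / (2 * Fintype.card V) * U.card ≤
      ((U.filter (HasCommonNbr G v)).card : ℝ) := by
  have hn : (0 : ℝ) < Fintype.card V := by
    have := hU0.choose
    exact_mod_cast Fintype.card_pos_iff.2 ⟨this⟩
  set n : ℝ := ((Fintype.card V : ℕ) : ℝ)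
  let c : V → ℝ := fun w => ((U.filter (fun u => G.Adj u w)).card : ℝ)
  have hS : ∑ w, c w = ∑ u ∈ U, (G.degree u : ℝ) := by
    have := Finset.sum_card_bipartiteAbove_eq_sum_card_bipartiteBelow (s := U)
      (t := Finset.univ) (fun u w => G.Adj u w)
    simp only [Finset.bipartiteAbove, Finset.bipartiteBelow] at this
    have h2 : ∀ u, G.degree u = (Finset.univ.filter (fun w => G.Adj u w)).card := fun u => by
      rw [← SimpleGraph.card_neighborFinset_eq_degree]; congr 1; ext; simp
    simp only [h2, c]
    exact_mod_cast this.symm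
  have hS1 : (d : ℝ) * U.card ≤ ∑ w, c w := by
    rw [hS, mul_comm, ← nsmul_eq_mul]
    exact Finset.card_nsmul_le_sum _ _ _ fun u _ => by exact_mod_cast hd u
  have hCS : (∑ w, c w) ^ 2 ≤ n * ∑ w, c w ^ 2 := by
    simpa using sq_sum_le_card_mul_sum_sq (s := (Finset.univ : Finset V)) (f := c)
  have hcount : ∑ w, c w ^ 2 ≤ ∑ w, c w + ∑ u ∈ U, ((U.filter (HasCommonNbr G u)).card : ℝ) := by
    have h1 : ∀ w, c w ^ 2 = c w +
        (((U.filter (fun u => G.Adj u w)).offDiag).card : ℝ) := fun w => by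
      rw [Finset.offDiag_card, Nat.cast_sub (Nat.le_mul_self _)]
      simp only [c]; push_cast; ring
    rw [Finset.sum_congr rfl fun w _ => h1 w, Finset.sum_add_distrib]
    gcongr
    have h2 : ∑ w, ((U.filter (fun u => G.Adj u w)).offDiag).card =
        (Finset.univ.sigma fun w => (U.filter (fun u => G.Adj u w)).offDiag).card :=
      (Finset.card_sigma _ _).symm
    have h3 : ∑ u ∈ U, (U.filter (HasCommonNbr G u)).card =
        (U.sigma fun u => U.filter (HasCommonNbr G u)).card := (Finset.card_sigma _ _).symm
    have h4 : (Finset.univ.sigma fun w => (U.filter (fun u => G.Adj u w)).offDiag).card ≤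
        (U.sigma fun u => U.filter (HasCommonNbr G u)).card := by
      refine Finset.card_le_card_of_injOn (fun p => ⟨p.2.1, p.2.2⟩) ?_ ?_
      · rintro ⟨w, u, v⟩ h
        simp at h ⊢
        exact ⟨h.1.1, h.2.1.1, h.2.2, w, h.1.2, h.2.1.2⟩
      · rintro ⟨w, u, v⟩ h ⟨w', u', v'⟩ h' heq
        simp at h h' heq
        obtain ⟨rfl, rfl⟩ := heq
        have : w = w' := by
          by_contra hne
          exact hG u v w w' h.2.2 hne h.1.2 h.2.1.2.symm h'.2.1.2 h'.1.2.symm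
        rw [this]
    rw [← h2, ← h3] at h4
    exact_mod_cast h4
  by_contra! hcon
  have hlt := Finset.sum_lt_sum_of_nonempty hU0 hcon
  rw [Finset.sum_const, nsmul_eq_mul] at hlt
  set s := ∑ w, c w
  set e := ∑ u ∈ U, ((U.filter (HasCommonNbr G u)).card : ℝ)
  have hlt' : 2 * n * e < (d * U.card) ^ 2 := by
    have : (U.card : ℝ) * ((d : ℝ) ^ 2 / (2 * n) * U.card) = (d * U.card) ^ 2 / (2 * n) := by ring
    rw [this, lt_div_iff₀ (by positivity)] at hlt
    linarith
  have h0 : 0 ≤ (d : ℝ) * U.card := by positivity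
  nlinarith [mul_le_mul_of_nonneg_left hcount hn.le, mul_nonneg (h0.trans hS1) (sub_nonneg.2 (hU.trans hS1)),
    mul_self_le_mul_self h0 hS1]

-- Taking `t = (n+1)^(1/8)` replaces logarithms by powers, as `log (n+1) ≤ 8t`. For `d ≤ t³` the
-- size bound alone suffices; otherwise the algorithm needs only `q = O(t³)` selections. The
-- constant is `17 * 8 + 8 + 2`: selections, then the two factors of `D`.
open Classical in
theorem card_independent_commonNbr_le {n : ℕ} (hn : 0 < n) {G : SimpleGraph (Fin n)}
    (hG : IsC4Free G) {d : ℕ} (hd : ∀ v, d ≤ G.degree v) (hdn : d ≤ n) {t : ℝ}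
    (ht : 1 ≤ t) (htn : t ^ 8 = n + 1) :
    (((Finset.univ : Finset (Finset (Fin n))).filter (fun S => S.card ≤ d + 1 ∧
      ∀ a ∈ S, ∀ b ∈ S, ¬ HasCommonNbr G a b)).card : ℝ) ≤ Real.exp (146 * t ^ 4) := by
  have hn' : (0 : ℝ) < n := by exact_mod_cast hn
  have ht0 : 0 < t := by linarith
  have hexp : (n : ℝ) + 1 ≤ Real.exp (8 * t) := by
    rw [← htn, mul_comm, Real.exp_mul, ← Real.rpow_natCast t 8]
    push_cast
    exact Real.rpow_le_rpow ht0.le (by linarith [Real.add_one_le_exp t]) (by norm_num)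
  have h34 : t ^ 3 ≤ t ^ 4 := pow_le_pow_right₀ ht (by norm_num)
  have h14 : t ≤ t ^ 4 := le_self_pow₀ ht (by norm_num)
  have h13 : 1 ≤ t ^ 3 := one_le_pow₀ ht
  rw [← Finset.powerset_univ]
  by_cases hdt : (d : ℝ) ≤ t ^ 3
  · have h1 : (((Finset.univ : Finset (Fin n)).powerset.filter (fun S => S.card ≤ d + 1 ∧
      ∀ a ∈ S, ∀ b ∈ S, ¬ HasCommonNbr G a b)).card : ℝ) ≤
      (((Finset.univ : Finset (Fin n)).powerset.filter (fun S => S.card ≤ d + 1)).card : ℝ) := by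
      exact Nat.cast_le.2 <| Finset.card_le_card fun S hS =>
      Finset.mem_filter.2 ⟨(Finset.mem_filter.1 hS).1, (Finset.mem_filter.1 hS).2.1⟩
    have h2 := card_powerset_filter_card_le (Finset.univ : Finset (Fin n)) (d + 1)
      (x := n + 1) (by linarith)
    refine (h1.trans h2).trans ?_
    rw [Finset.card_univ, Fintype.card_fin]
    calc _ ≤ Real.exp (8 * t) ^ (d + 1) * Real.exp 1 := by
            gcongr
            rw [div_le_one (by positivity)]; linarith
      _ = Real.exp ((d + 1) * (8 * t) + 1) := by
            rw [← Real.exp_nat_mul, ← Real.exp_add]; push_cast; rfl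
      _ ≤ _ := by
            gcongr
            nlinarith [mul_le_mul_of_nonneg_right hdt ht0.le]
  push Not at hdt
  have hd1 : (1 : ℝ) < d := by linarith
  have hd2 : (2 : ℝ) ≤ d := by exact_mod_cast (by exact_mod_cast hd1 : 1 < d)
  have hd0 : (0 : ℝ) < d := by linarith
  set β : ℝ := (d : ℝ) ^ 2 / (2 * n) with hβ
  have hβ0 : 0 < β := by positivity
  have key : ∀ U : Finset (Fin n), 2 * (n : ℝ) / d ≤ U.card → ∃ v ∈ U, β * U.card ≤
      ((U.filter (HasCommonNbr G v)).card : ℝ) := by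
    intro U hU
    have h0 : 0 < (U.card : ℝ) := lt_of_lt_of_le (by positivity) hU
    have := exists_many_hasCommonNbr hG hd U (Finset.card_pos.1 (by exact_mod_cast h0))
      (by rw [Fintype.card_fin]; rw [div_le_iff₀ hd0] at hU; linarith)
    rwa [Fintype.card_fin] at this
  have hβ1 : β ≤ 1 := by
    obtain ⟨v, -, hv⟩ := key Finset.univ (by
      rw [Finset.card_univ, Fintype.card_fin, div_le_iff₀ hd0]; nlinarith)
    have h2 : ((Finset.univ.filter (HasCommonNbr G v)).card : ℝ) ≤ n := by
      have := Finset.card_filter_le (Finset.univ : Finset (Fin n)) (HasCommonNbr G v)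
      rw [Finset.card_univ, Fintype.card_fin] at this
      exact_mod_cast this
    rw [Finset.card_univ, Fintype.card_fin] at hv
    by_contra! hlt
    nlinarith
  have hdsq : (d : ℝ) ^ 2 ≤ 2 * n := by
    rwa [hβ, div_le_one (by positivity)] at hβ1
  -- Chosen so that `(1 - β)^q ≤ exp (-8t) ≤ 1/(n+1) ≤ 1/d`, which brings `n` vertices below `2n/d`.
  set q : ℕ := ⌈8 * t / β⌉₊ with hq
  have hq1 : 8 * t ≤ β * q := by
    have := Nat.le_ceil (8 * t / β)
    rw [div_le_iff₀ hβ0] at this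
    linarith
  have hq2 : (q : ℝ) ≤ 17 * t ^ 3 := by
    have h1 : (q : ℝ) < 8 * t / β + 1 := Nat.ceil_lt_add_one (by positivity)
    have h2 : 8 * t / β ≤ 16 * t ^ 3 := by
      rw [div_le_iff₀ hβ0, hβ, mul_div_assoc', le_div_iff₀ (by positivity)]
      have h6 : t ^ 6 ≤ (d : ℝ) ^ 2 := by nlinarith [pow_pos ht0 3]
      have h9 : t ^ 3 * t ^ 6 = t * (n + 1) := by rw [← htn]; ring
      have := mul_le_mul_of_nonneg_left h6 (pow_pos ht0 3).le
      nlinarith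
    linarith
  -- Roughly the ratio of the final size `2n/d` to `d`, which balances both factors of the subset
  -- bound.
  set x : ℝ := 2 * t ^ 8 / (d : ℝ) ^ 2 with hx
  have hx1 : 1 ≤ x := by
    rw [hx, le_div_iff₀ (by positivity)]; linarith
  have hdt4 : (d : ℝ) ≤ 2 * t ^ 4 := by
    refine (pow_le_pow_iff_left₀ hd0.le (by positivity) two_ne_zero).1 ?_
    nlinarith
  have hxm : x ^ (d + 1) ≤ Real.exp (8 * t ^ 4) := by
    have h1 : x ≤ (Real.exp (2 * t ^ 4 / d)) ^ 2 := by
      have h2 : x ≤ (2 * t ^ 4 / d) ^ 2 := by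
        rw [hx, div_pow]; gcongr; nlinarith [pow_pos ht0 8]
      refine h2.trans (pow_le_pow_left₀ (by positivity) ?_ 2)
      linarith [Real.add_one_le_exp (2 * t ^ 4 / d)]
    calc x ^ (d + 1) ≤ ((Real.exp (2 * t ^ 4 / d)) ^ 2) ^ (d + 1) := by gcongr
      _ = Real.exp ((2 * (d + 1)) * (2 * t ^ 4 / d)) := by
          rw [← pow_mul, ← Real.exp_nat_mul]; push_cast; rfl
      _ ≤ _ := by
          refine Real.exp_le_exp.2 ?_
          rw [mul_div_assoc', div_le_iff₀ hd0]
          nlinarith [pow_pos ht0 4]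
  have hmain := card_independent_le (HasCommonNbr G) (β := β) (R := 2 * n / d)
    (D := Real.exp (8 * t ^ 4) * Real.exp (2 * t ^ 4)) (d + 1) hβ1 (fun U hU => key U hU.le)
    (fun U hU => ?_) (by positivity) q Finset.univ ?_
  · refine le_trans (le_of_eq (by congr!)) (hmain.trans ?_)
    rw [Finset.card_univ, Fintype.card_fin]
    calc _ ≤ Real.exp (8 * t) ^ q * (Real.exp (8 * t ^ 4) * Real.exp (2 * t ^ 4)) := by gcongr
      _ = Real.exp (q * (8 * t) + (8 * t ^ 4 + 2 * t ^ 4)) := by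
          rw [← Real.exp_nat_mul, ← Real.exp_add, ← Real.exp_add]
      _ ≤ _ := by
          gcongr
          nlinarith [mul_le_mul_of_nonneg_right hq2 ht0.le]
  · refine (card_powerset_filter_card_le U (d + 1) hx1).trans ?_
    gcongr
    rw [div_le_iff₀ (by linarith)]
    refine hU.trans ?_
    have : (d : ℝ) * x ≤ 2 * t ^ 4 * x := by gcongr
    refine le_trans ?_ this
    rw [hx, mul_div_assoc', div_le_div_iff₀ hd0 (by positivity), htn]
    nlinarith [pow_pos hd0 3]
  · rw [Finset.card_univ, Fintype.card_fin]
    have h1 : (1 - β) ^ q ≤ Real.exp (-(β * q)) := by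
      rw [neg_mul_eq_neg_mul, mul_comm, Real.exp_nat_mul]
      exact pow_le_pow_left₀ (by linarith) (by linarith [Real.add_one_le_exp (-β)]) q
    have h2 : Real.exp (-(β * q)) ≤ 1 / d := by
      rw [Real.exp_neg, ← one_div]
      apply one_div_le_one_div_of_le hd0
      have : (d : ℝ) ≤ n := by exact_mod_cast hdn
      linarith [Real.exp_le_exp.2 hq1]
    calc (n : ℝ) * (1 - β) ^ q ≤ n * (1 / d) := by gcongr; exact h1.trans h2
      _ ≤ 2 * n / d := by rw [mul_one_div]; gcongr; linarith

/-! ### The Kleitman–Winston induction -/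

open Classical in
/-- The possible neighbourhoods of a new vertex of minimum degree, added to the graph `G`. -/
noncomputable def minDegreeExtensions {n : ℕ} (G : SimpleGraph (Fin n)) :
    Finset (Finset (Fin n)) :=
  Finset.univ.filter fun S => (∀ i, S.card ≤ G.degree i + 1) ∧
    ∀ a ∈ S, ∀ b ∈ S, ¬ HasCommonNbr G a b

theorem card_minDegreeExtensions_le {n : ℕ} {G : SimpleGraph (Fin n)} (hG : IsC4Free G) :
    ((minDegreeExtensions G).card : ℝ) ≤ Real.exp (146 * √(n + 1)) := by
  classical
  rcases Nat.eq_zero_or_pos n with rfl | hn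
  · have h1 : (minDegreeExtensions G).card ≤ 1 := by
      refine (Finset.card_le_univ _).trans ?_
      simp
    have h1' : ((minDegreeExtensions G).card : ℝ) ≤ 1 := by exact_mod_cast h1
    exact h1'.trans (Real.one_le_exp (by positivity))
  have : Nonempty (Fin n) := ⟨⟨0, hn⟩⟩
  set t : ℝ := ((n : ℝ) + 1) ^ (1 / 8 : ℝ) with ht
  have ht8 : t ^ 8 = n + 1 := by
    rw [ht, ← Real.rpow_natCast, ← Real.rpow_mul (by positivity)]; norm_num
  have ht4 : √((n : ℝ) + 1) = t ^ 4 := by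
    rw [← ht8, show t ^ 8 = (t ^ 4) ^ 2 by ring, Real.sqrt_sq (by positivity)]
  have ht1 : 1 ≤ t := Real.one_le_rpow (by linarith [Nat.cast_nonneg (α := ℝ) n]) (by norm_num)
  obtain ⟨v, hv⟩ := G.exists_minimal_degree_vertex
  rw [ht4]
  refine le_trans ?_ (card_independent_commonNbr_le hn hG (d := G.minDegree)
    (fun v => G.minDegree_le_degree v) ?_ ht1 ht8)
  · rw [minDegreeExtensions]
    norm_cast
    refine Finset.card_le_card ?_
    intro S hS
    simp only [Finset.mem_filter, Finset.mem_univ, true_and] at hS ⊢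
    refine ⟨?_, hS.2⟩
    rw [hv]
    convert hS.1 v
  · rw [hv]
    exact (G.degree_lt_card_verts v).le.trans (by simp)

open Classical in
noncomputable def c4FreeGraphs (n : ℕ) : Finset (SimpleGraph (Fin n)) :=
  Finset.univ.filter IsC4Free

/-- A graph is recovered from a minimum-degree vertex, the graph on the rest and the neighbourhood.
Deletion lowers degrees by at most one, and a common neighbour of two neighbours of the deleted
vertex would close a 4-cycle. -/
theorem card_c4FreeGraphs_succ_le (n : ℕ) :
    ((c4FreeGraphs (n + 1)).card : ℝ) ≤
      (n + 1) * ((c4FreeGraphs n).card * Real.exp (146 * √(n + 1))) := by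
  classical
  have hinj : (c4FreeGraphs (n + 1)).card ≤ ((Finset.univ : Finset (Fin (n + 1))) ×ˢ
      ((c4FreeGraphs n).sigma minDegreeExtensions)).card := by
    choose v hv using fun G : SimpleGraph (Fin (n + 1)) => G.exists_minimal_degree_vertex
    refine Finset.card_le_card_of_injOn (fun G => (v G, ⟨G.comap (v G).succAbove,
      Finset.univ.filter (fun i => G.Adj (v G) ((v G).succAbove i))⟩)) ?_ ?_
    · intro G hG
      have hG : IsC4Free G := by simpa [c4FreeGraphs] using hG
      simp only [Finset.coe_product, Finset.coe_univ, Set.mem_prod, Set.mem_univ, true_and,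
        Finset.mem_coe, Finset.mem_sigma]
      constructor
      · simp only [c4FreeGraphs, Finset.mem_filter, Finset.mem_univ, true_and]
        intro a b c d hab hcd
        exact hG _ _ _ _ (Fin.succAbove_right_injective.ne hab)
          (Fin.succAbove_right_injective.ne hcd)
      · simp only [minDegreeExtensions, Finset.mem_filter, Finset.mem_univ, true_and]
        constructor
        · intro i
          have h1 : (Finset.univ.filter
              (fun i => G.Adj (v G) ((v G).succAbove i))).card ≤ G.degree (v G) := by
            rw [← SimpleGraph.card_neighborFinset_eq_degree]
            refine Finset.card_le_card_of_injOn (v G).succAbove ?_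
              Fin.succAbove_right_injective.injOn
            intro i hi
            simpa using hi
          have h2 : G.degree (v G) ≤ G.degree ((v G).succAbove i) := by
            rw [← hv]; exact G.minDegree_le_degree _
          have h3 : G.degree ((v G).succAbove i) ≤
              (G.comap (v G).succAbove).degree i + 1 := by
            rw [← SimpleGraph.card_neighborFinset_eq_degree,
              ← SimpleGraph.card_neighborFinset_eq_degree]
            have : G.neighborFinset ((v G).succAbove i) ⊆
                insert (v G) (((G.comap (v G).succAbove).neighborFinset i).image
                  (v G).succAbove) := by
              intro w hw
              rw [Finset.mem_insert, Finset.mem_image]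
              by_cases hwv : w = v G
              · exact Or.inl hwv
              · obtain ⟨j, rfl⟩ := Fin.exists_succAbove_eq hwv
                exact Or.inr ⟨j, by simpa using hw, rfl⟩
            exact (Finset.card_le_card this).trans ((Finset.card_insert_le _ _).trans
              (Nat.succ_le_succ Finset.card_image_le))
          have h4 := h1.trans (h2.trans h3)
          convert h4
          rfl
        · rintro a ha b hb ⟨hab, w, haw, hbw⟩
          exact hG _ _ _ _ (Fin.succAbove_right_injective.ne hab)
            (Fin.succAbove_ne (v G) w).symm ha.symm hb hbw haw.symm
    · intro G _ G' _ h
      simp only [Prod.mk.injEq, Sigma.mk.injEq] at h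
      obtain ⟨hv', hc, hs⟩ := h
      rw [← hv'] at hc hs
      have hs := eq_of_heq hs
      have hN : ∀ j, G.Adj (v G) ((v G).succAbove j) ↔ G'.Adj (v G) ((v G).succAbove j) := by
        intro j
        simpa using Finset.ext_iff.1 hs j
      ext a b
      rcases Fin.eq_self_or_eq_succAbove (v G) a with ha | ⟨i, ha⟩ <;>
      rcases Fin.eq_self_or_eq_succAbove (v G) b with hb | ⟨j, hb⟩
      · rw [ha, hb]; simp
      · rw [ha, hb]; exact hN j
      · rw [ha, hb, G.adj_comm, G'.adj_comm]; exact hN i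
      · rw [ha, hb]
        have := congrArg (fun K : SimpleGraph (Fin n) => K.Adj i j) hc
        simpa using this
  rw [Finset.card_product, Finset.card_sigma, Finset.card_univ, Fintype.card_fin] at hinj
  have hinj' : ((c4FreeGraphs (n + 1)).card : ℝ) ≤
      (n + 1) * ∑ G ∈ c4FreeGraphs n, ((minDegreeExtensions G).card : ℝ) := by
    exact_mod_cast hinj
  refine hinj'.trans ?_
  gcongr
  rw [← nsmul_eq_mul]
  refine Finset.sum_le_card_nsmul _ _ _ fun G hG => card_minDegreeExtensions_le ?_
  simpa [c4FreeGraphs] using hG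

/-- The Kleitman–Winston theorem: the number of `C_4`-free graphs on `n` vertices is
`exp (O (n ^ (3 / 2)))`. -/
theorem card_c4FreeGraphs_le (n : ℕ) :
    ((c4FreeGraphs n).card : ℝ) ≤ Real.exp (148 * (n * √n)) := by
  induction n with
  | zero =>
    have : (c4FreeGraphs 0).card ≤ 1 := by
      refine (Finset.card_le_univ _).trans ?_
      exact Fintype.card_le_one_iff_subsingleton.2 ⟨fun G H => by ext a; exact a.elim0⟩
    simpa using this
  | succ n ih =>
    refine (card_c4FreeGraphs_succ_le n).trans ?_
    -- Absorbs the choice of the deleted vertex; hence `148 = 146 + 2`.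
    have h1 : (n : ℝ) + 1 ≤ Real.exp (2 * √(n + 1)) := by
      have h := Real.add_one_le_exp √((n : ℝ) + 1)
      have h0 := Real.sqrt_nonneg ((n : ℝ) + 1)
      have hs := Real.sq_sqrt (show (0 : ℝ) ≤ n + 1 by positivity)
      rw [two_mul, Real.exp_add]
      nlinarith
    calc ((n : ℝ) + 1) * ((c4FreeGraphs n).card * Real.exp (146 * √(n + 1)))
        ≤ Real.exp (2 * √(n + 1)) * (Real.exp (148 * (n * √n)) * Real.exp (146 * √(n + 1))) := by
          gcongr
      _ = Real.exp (148 * (n * √n) + 148 * √(n + 1)) := by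
          rw [← Real.exp_add, ← Real.exp_add]; congr 1; ring
      _ ≤ _ := by
          push_cast
          gcongr
          have : √(n : ℝ) ≤ √((n : ℝ) + 1) := Real.sqrt_le_sqrt (by linarith)
          nlinarith [Nat.cast_nonneg (α := ℝ) n]

/-! ### Position graphs of a hypergraph -/

/-- The number of elements of `e` below `a`. -/
noncomputable def position {n : ℕ} (e : Set (Fin n)) (a : Fin n) : ℕ :=
  {b | b ∈ e ∧ b < a}.ncard

theorem position_lt_ncard {n : ℕ} {e : Set (Fin n)} {a : Fin n} (ha : a ∈ e) :
    position e a < e.ncard :=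
  Set.ncard_lt_ncard ⟨fun _ h => h.1, fun h => lt_irrefl a (h ha).2⟩ (Set.toFinite _)

theorem position_lt_position {n : ℕ} {e : Set (Fin n)} {a b : Fin n} (ha : a ∈ e) (hab : a < b) :
    position e a < position e b :=
  Set.ncard_lt_ncard ⟨fun _ h => ⟨h.1, h.2.trans hab⟩, fun h => lt_irrefl a (h ⟨ha, hab⟩).2⟩
    (Set.toFinite _)

theorem position_injOn {n : ℕ} (e : Set (Fin n)) : Set.InjOn (position e) e := by
  intro a ha b hb h
  rcases lt_trichotomy a b with hab | hab | hab
  · exact absurd h (position_lt_position ha hab).ne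
  · exact hab
  · exact absurd h (position_lt_position hb hab).ne'

/-- The graph which joins, in every hyperedge, the vertices in the positions `i` and `j`. -/
def positionGraph {n : ℕ} (H : Hypergraph (Fin n)) (i j : ℕ) : SimpleGraph (Fin n) where
  Adj a b := a ≠ b ∧ ∃ e ∈ H.edgeSet, a ∈ e ∧ b ∈ e ∧
    ((position e a = i ∧ position e b = j) ∨ (position e a = j ∧ position e b = i))
  symm := ⟨fun _ _ ⟨hab, e, he, ha, hb, h⟩ => ⟨hab.symm, e, he, hb, ha, h.symm.imp And.symm And.symm⟩⟩
  loopless := ⟨fun _ h => h.1 rfl⟩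

/-- Positions are injective on a hyperedge, so it contributes at most one edge to each position
graph. -/
theorem pair_eq_of_position {n : ℕ} {e : Set (Fin n)} {i j : ℕ} {a b c d : Fin n}
    (ha : a ∈ e) (hb : b ∈ e) (hc : c ∈ e) (hd : d ∈ e)
    (h : (position e a = i ∧ position e b = j) ∨ (position e a = j ∧ position e b = i))
    (h' : (position e c = i ∧ position e d = j) ∨ (position e c = j ∧ position e d = i)) :
    (a = c ∧ b = d) ∨ (a = d ∧ b = c) := by
  have key : ∀ {x y}, x ∈ e → y ∈ e → position e x = position e y → x = y :=
    fun hx hy hxy => position_injOn e hx hy hxy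
  rcases h with ⟨h1, h2⟩ | ⟨h1, h2⟩ <;> rcases h' with ⟨h3, h4⟩ | ⟨h3, h4⟩
  · exact Or.inl ⟨key ha hc (h1.trans h3.symm), key hb hd (h2.trans h4.symm)⟩
  · exact Or.inr ⟨key ha hd (h1.trans h4.symm), key hb hc (h2.trans h3.symm)⟩
  · exact Or.inr ⟨key ha hd (h1.trans h4.symm), key hb hc (h2.trans h3.symm)⟩
  · exact Or.inl ⟨key ha hc (h1.trans h3.symm), key hb hd (h2.trans h4.symm)⟩

/-! ### Berge cycles and reconstruction from the position graphs -/

theorem containsBerge_two {α : Type*} {H : Hypergraph α} {a b : α} {e f : Set α}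
    (he : e ∈ H.edgeSet) (hf : f ∈ H.edgeSet) (hab : a ≠ b) (hef : e ≠ f)
    (hae : a ∈ e) (hbe : b ∈ e) (haf : a ∈ f) (hbf : b ∈ f) : ContainsBerge (cycle 2) H := by
  refine (containsBerge_cycle_iff H 2).2 ⟨![a, b], ![e, f], ?_, ?_, ?_⟩
  · intro x y; fin_cases x <;> fin_cases y <;> simp [hab, hab.symm]
  · intro x y; fin_cases x <;> fin_cases y <;> simp [hef, hef.symm]
  · intro i; fin_cases i <;> simp [*]

theorem containsBerge_three {α : Type*} {H : Hypergraph α} {a b c : α} {e f g : Set α}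
    (he : e ∈ H.edgeSet) (hf : f ∈ H.edgeSet) (hg : g ∈ H.edgeSet)
    (hab : a ≠ b) (hac : a ≠ c) (hbc : b ≠ c) (hef : e ≠ f) (heg : e ≠ g) (hfg : f ≠ g)
    (hae : a ∈ e) (hbe : b ∈ e) (hbf : b ∈ f) (hcf : c ∈ f) (hcg : c ∈ g) (hag : a ∈ g) :
    ContainsBerge (cycle 3) H := by
  refine (containsBerge_cycle_iff H 3).2 ⟨![a, b, c], ![e, f, g], ?_, ?_, ?_⟩
  · intro x y; fin_cases x <;> fin_cases y <;> simp [hab, hab.symm, hac, hac.symm, hbc, hbc.symm]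
  · intro x y; fin_cases x <;> fin_cases y <;> simp [hef, hef.symm, heg, heg.symm, hfg, hfg.symm]
  · intro i; fin_cases i <;> simp [*]

theorem containsBerge_four {α : Type*} {H : Hypergraph α} {a b c d : α} {e f g h : Set α}
    (he : e ∈ H.edgeSet) (hf : f ∈ H.edgeSet) (hg : g ∈ H.edgeSet) (hh : h ∈ H.edgeSet)
    (hab : a ≠ b) (hac : a ≠ c) (had : a ≠ d) (hbc : b ≠ c) (hbd : b ≠ d) (hcd : c ≠ d)
    (hef : e ≠ f) (heg : e ≠ g) (heh : e ≠ h) (hfg : f ≠ g) (hfh : f ≠ h) (hgh : g ≠ h)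
    (hae : a ∈ e) (hbe : b ∈ e) (hbf : b ∈ f) (hcf : c ∈ f) (hcg : c ∈ g) (hdg : d ∈ g)
    (hdh : d ∈ h) (hah : a ∈ h) : ContainsBerge (cycle 4) H := by
  refine (containsBerge_cycle_iff H 4).2 ⟨![a, b, c, d], ![e, f, g, h], ?_, ?_, ?_⟩
  · intro x y
    fin_cases x <;> fin_cases y <;> simp [hab, hab.symm, hac, hac.symm, hbc, hbc.symm, had,
      had.symm, hbd, hbd.symm, hcd, hcd.symm]
  · intro x y
    fin_cases x <;> fin_cases y <;> simp [hef, hef.symm, heg, heg.symm, hfg, hfg.symm, heh,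
      heh.symm, hfh, hfh.symm, hgh, hgh.symm]
  · intro i; fin_cases i <;> simp [*]

/-- If two of the four hyperedges coincided, two edges of the 4-cycle would coincide by
`pair_eq_of_position`. -/
theorem isC4Free_positionGraph {n : ℕ} {H : Hypergraph (Fin n)}
    (hH : ¬ ContainsBerge (cycle 4) H) (i j : ℕ) : IsC4Free (positionGraph H i j) := by
  rintro a b c d hab hcd ⟨hac, e₁, h₁, a₁, c₁, p₁⟩ ⟨hcb, e₂, h₂, c₂, b₂, p₂⟩
    ⟨hbd, e₃, h₃, b₃, d₃, p₃⟩ ⟨hda, e₄, h₄, d₄, a₄, p₄⟩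
  refine hH (containsBerge_four h₁ h₂ h₃ h₄ hac hab hda.symm hcb hcd hbd ?_ ?_ ?_ ?_ ?_ ?_
    a₁ c₁ c₂ b₂ b₃ d₃ d₄ a₄)
  · rintro rfl
    rcases pair_eq_of_position a₁ c₁ c₂ b₂ p₁ p₂ with h | h
    exacts [hac h.1, hab h.1]
  · rintro rfl
    rcases pair_eq_of_position a₁ c₁ b₃ d₃ p₁ p₃ with h | h
    exacts [hab h.1, hda h.1.symm]
  · rintro rfl
    rcases pair_eq_of_position a₁ c₁ d₄ a₄ p₁ p₄ with h | h
    exacts [hda h.1.symm, hcd h.2]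
  · rintro rfl
    rcases pair_eq_of_position c₂ b₂ b₃ d₃ p₂ p₃ with h | h
    exacts [hcb h.1, hcd h.1]
  · rintro rfl
    rcases pair_eq_of_position c₂ b₂ d₄ a₄ p₂ p₄ with h | h
    exacts [hcd h.1, hac h.1.symm]
  · rintro rfl
    rcases pair_eq_of_position b₃ d₃ d₄ a₄ p₃ p₄ with h | h
    exacts [hbd h.1, hab h.1.symm]

/-- In a hypergraph without Berge cycles of length two and three, a set of at least two vertices
any two of which are adjacent is contained in an edge. -/
theorem exists_edge_superset {α : Type*} {H : Hypergraph α}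
    (h2 : ¬ ContainsBerge (cycle 2) H) (h3 : ¬ ContainsBerge (cycle 3) H) {s : Set α}
    (hs : s.Nontrivial) (hadj : s.Pairwise H.Adj) : ∃ e ∈ H.edgeSet, s ⊆ e := by
  obtain ⟨a, ha, b, hb, hab⟩ := hs
  obtain ⟨f, hf, haf, hbf⟩ := hadj ha hb hab
  refine ⟨f, hf, fun c hc => ?_⟩
  by_contra hcf
  have hac : a ≠ c := by rintro rfl; exact hcf haf
  have hbc : b ≠ c := by rintro rfl; exact hcf hbf
  obtain ⟨g, hg, hag, hcg⟩ := hadj ha hc hac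
  obtain ⟨k, hk, hbk, hck⟩ := hadj hb hc hbc
  have hfg : f ≠ g := by rintro rfl; exact hcf hcg
  have hfk : f ≠ k := by rintro rfl; exact hcf hck
  -- If `k = g`, this hyperedge shares `a` and `b` with `f`; otherwise `f`, `k`, `g` form a Berge
  -- triangle.
  by_cases hkg : k = g
  · subst hkg
    exact h2 (containsBerge_two hf hg hab hfg haf hbf hag hbk)
  · exact h3 (containsBerge_three hf hk hg hab hac hbc hfk hfg hkg haf hbf hbk hck hcg hag)

/-- Each pair in an edge of `H` is recorded in the graph of its two positions, so the edge is a
clique in the shadow of `K` and lies in an edge of `K`; uniformity makes them equal. -/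
theorem edgeSet_subset_of_positionGraph_eq {n r : ℕ} (hr : 2 ≤ r) {H K : Hypergraph (Fin n)}
    (hH : IsUniform r H) (hK : IsUniform r K)
    (h2 : ¬ ContainsBerge (cycle 2) K) (h3 : ¬ ContainsBerge (cycle 3) K)
    (h : ∀ i j : Fin r, positionGraph H i j = positionGraph K i j) : H.edgeSet ⊆ K.edgeSet := by
  intro e he
  have hcard : e.ncard = r := by rw [Set.ncard_def, hH e he]; rfl
  have hnt : e.Nontrivial := (Set.one_lt_ncard_iff_nontrivial).1 (by omega)
  have hadj : e.Pairwise K.Adj := by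
    intro a ha b hb hab
    have hG : (positionGraph H (position e a) (position e b)).Adj a b :=
      ⟨hab, e, he, ha, hb, Or.inl ⟨rfl, rfl⟩⟩
    rw [h ⟨_, hcard ▸ position_lt_ncard ha⟩ ⟨_, hcard ▸ position_lt_ncard hb⟩] at hG
    obtain ⟨-, f, hf, haf, hbf, -⟩ := hG
    exact ⟨f, hf, haf, hbf⟩
  obtain ⟨f, hf, hef⟩ := exists_edge_superset h2 h3 hnt hadj
  have : e = f := (Set.toFinite e).eq_of_subset_of_encard_le hef (by rw [hH e he, hK f hf])
  rwa [this]

theorem ncard_rGraphsOfGirthAtLeast_five_le {r : ℕ} (hr : 2 ≤ r) (n : ℕ) :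
    (rGraphsOfGirthAtLeast r n 5).ncard ≤ (c4FreeGraphs n).card ^ (r * r) := by
  have hc : Nat.card (Fin r × Fin r → c4FreeGraphs n) = (c4FreeGraphs n).card ^ (r * r) := by
    simp
  have hB : ∀ H ∈ rGraphsOfGirthAtLeast r n 5, ∀ k, 2 ≤ k → k < 5 →
      ¬ ContainsBerge (cycle k) H := fun H hH => (le_girth_iff H 5).1 hH.2.2
  rw [← hc, ← Nat.card_coe_set_eq]
  refine Nat.card_le_card_of_injective (fun H p => ⟨positionGraph H.1 p.1 p.2, ?_⟩) ?_
  · simpa [c4FreeGraphs] using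
      isC4Free_positionGraph (hB _ H.2 4 (by norm_num) (by norm_num)) p.1 p.2
  · rintro ⟨H, hH⟩ ⟨K, hK⟩ hHK
    have h : ∀ i j : Fin r, positionGraph H i j = positionGraph K i j := fun i j =>
      congrArg Subtype.val (congrFun hHK (i, j))
    refine Subtype.ext (Hypergraph.ext (hH.1.trans hK.1.symm) (Set.Subset.antisymm ?_ ?_))
    · exact edgeSet_subset_of_positionGraph_eq hr hH.2.1 hK.2.1
        (hB K hK 2 (by norm_num) (by norm_num)) (hB K hK 3 (by norm_num) (by norm_num)) h
    · exact edgeSet_subset_of_positionGraph_eq hr hK.2.1 hH.2.1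
        (hB H hH 2 (by norm_num) (by norm_num)) (hB H hH 3 (by norm_num) (by norm_num))
        fun i j => (h i j).symm

end BergeGirth

/-! ### Conclusion -/

theorem mainTheorem7 (r : ℕ) (hr : 2 ≤ r) :
    ∃ C : ℝ, ∀ n : ℕ,
      ((BergeGirth.rGraphsOfGirthAtLeast r n 5).ncard : ℝ) ≤
        (2 : ℝ) ^ (C * (n : ℝ) ^ (3 / 2 : ℝ)) := by
  -- One factor `exp (148 n^(3/2))` for each of the `r * r` position graphs; `log 2` converts to
  -- base 2.
  refine ⟨148 * (r * r) / Real.log 2, fun n => ?_⟩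
  have h1 : ((BergeGirth.rGraphsOfGirthAtLeast r n 5).ncard : ℝ) ≤
      ((BergeGirth.c4FreeGraphs n).card : ℝ) ^ (r * r) := by
    exact_mod_cast BergeGirth.ncard_rGraphsOfGirthAtLeast_five_le hr n
  have h32 : (n : ℝ) ^ (3 / 2 : ℝ) = n * √n := by
    rw [Real.sqrt_eq_rpow, show (3 / 2 : ℝ) = 1 + 1 / 2 by norm_num,
      Real.rpow_add_of_nonneg (by positivity) (by norm_num) (by norm_num), Real.rpow_one]
  have hlog : Real.log 2 ≠ 0 := (Real.log_pos (by norm_num)).ne'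
  calc _ ≤ _ := h1
    _ ≤ Real.exp (148 * (n * √n)) ^ (r * r) := by
        gcongr; exact BergeGirth.card_c4FreeGraphs_le n
    _ = _ := by
        rw [← Real.exp_nat_mul, h32, Real.rpow_def_of_pos (by norm_num)]
        congr 1
        push_cast
        field_simp
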